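/- **Setting.** Let $\mathcal X$ be a measurable space, $\mathcal Y=\mathcal Y_1\times\dots\times\mathcal Y_\ell$ a product of finite label sets, and $\mathcal C$ a finite set of cliques $c\subseteq\{1,\dots,\ell\}$. For $y\in\mathcal Y$ write $y_c=(y_i)_{i\in c}$, let $\mathcal Y_c=\prod_{i\in c}\mathcal Y_i$, and let $m=\sum_{c\in\mathcal C}|\mathcal Y_c|$ be the total number of clique assignments. Let $\mathbf f_c(x,y_c)\in\mathbb R^d$ be clique features (measurable in $x$) with $\|\mathbf f_c(x,y_c)\|_2\le 1$ for all $x\in\mathcal X$, $c\in\mathcal C$, $y_c\in\mathcal Y_c$. For $\theta\in\mathbb R^d$ define the score $\theta(x,y)=\theta^\top\sum_{c\in\mathcal C}\mathbf f_c(x,y_c)$, the max-marginals $\theta^\star(x,y_c)=\max_{y':\,y'_c=y_c}\theta(x,y')$, and, for $\alpha\in[0,1]$, the threshold $$\tau(x;\theta,\alpha)=\alpha\max_{y}\theta(x,y)+(1-\alpha)\frac1m\sum_{c\in\mathcal C}\sum_{y_c\in\mathcal Y_c}\theta^\star(x,y_c).$$ For $\gamma>0$ let $r_\gamma(z)=1$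 if $z<0$, $r_\gamma(z)=1-z/\gamma$ if $0\le z\le\gamma$, and $r_\gamma(z)=0$ if $z>\gamma$. Define the filtering and efficiency losses and their $\gamma$-margin versions by $$\mathcal L_f(x,y;\theta,\alpha)=\mathbf 1[\theta(x,y)\le\tau(x;\theta,\alpha)],\qquad \mathcal L_f^\gamma(x,y;\theta,\alpha)=r_\gamma\big(\theta(x,y)-\tau(x;\theta,\alpha)\big),$$ $$\mathcal L_e(x,y;\theta,\alpha)=\frac1m\sum_{c\in\mathcal C}\sum_{y_c\in\mathcal Y_c}\mathbf 1[\theta^\star(x,y_c)>\tau(x;\theta,\alpha)],\qquad \mathcal L_e^\gamma(x,y;\theta,\alpha)=\frac1m\sum_{c\in\mathcal C}\sum_{y_c\in\mathcal Y_c}r_\gamma\big(\tau(x;\theta,\alpha)-\theta^\star(x,y_c)\big).$$ **Theorem.** There is an absolute constant $c$ such that, in every such setting, for every probability distribution $D$ of $(X,Y)$ on $\mathcal X\times\mathcal Y$, all $\alpha\in[0,1]$, $\gamma>0$, $B$, every integer $n\ge1$ and every $0<\delta<1$, with probability at least $1-\delta$ over an i.i.d. sample of size $n$ from $D$, every $\theta\in\mathbb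 R^d$ with $\|\theta\|_2\le B$ satisfies both $$\mathbb E[\mathcal L_f(X,Y;\theta,\alpha)]\le\hat{\mathbb E}[\mathcal L_f^\gamma(X,Y;\theta,\alpha)]+\frac{c\,mB\sqrt{|\mathcal C|}}{\gamma\sqrt n}+\sqrt{\frac{8\ln(2/\delta)}{n}}$$ and $$\mathbb E[\mathcal L_e(X,Y;\theta,\alpha)]\le\hat{\mathbb E}[\mathcal L_e^\gamma(X,Y;\theta,\alpha)]+\frac{c\,mB\sqrt{|\mathcal C|}}{\gamma\sqrt n}+\sqrt{\frac{8\ln(2/\delta)}{n}},$$ where $\hat{\mathbb E}$ is the empirical expectation with respect to the sample. -/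

import Mathlib

open MeasureTheory

noncomputable section

namespace SPC

/-- The output space `Y = Y_1 × ⋯ × Y_ℓ`, the `i`-th variable having `K i` labels. -/
abbrev Output {ℓ : ℕ} (K : Fin ℓ → ℕ) : Type := ∀ i, Fin (K i)

/-- The set `Y_c` of all assignments to the variables of the clique `c`. The assignment `y_c`
that an output `y` induces on `c` is `c.restrict y`. -/
abbrev CliqueAssignment {ℓ : ℕ} (K : Fin ℓ → ℕ) (c : Finset (Fin ℓ)) : Type :=
  ∀ i : c, Fin (K i)

/-- Clique features: `f c x yc ∈ ℝ^d` is the feature vector `f_c(x, y_c)`. -/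
abbrev CliqueFeatures (X : Type*) {ℓ : ℕ} (K : Fin ℓ → ℕ) (d : ℕ) :=
  ∀ c : Finset (Fin ℓ), X → CliqueAssignment K c → EuclideanSpace ℝ (Fin d)

/-- The total number `m = ∑_{c ∈ C} |Y_c|` of clique assignments. -/
def numAssignments {ℓ : ℕ} (K : Fin ℓ → ℕ) (C : Finset (Finset (Fin ℓ))) : ℕ :=
  ∑ c ∈ C, Fintype.card (CliqueAssignment K c)

variable {X : Type*} {ℓ d : ℕ} {K : Fin ℓ → ℕ}

/-- The feature function `f(x, y) = ∑_{c ∈ C} f_c(x, y_c)`. -/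
def featureMap (C : Finset (Finset (Fin ℓ))) (f : CliqueFeatures X K d)
    (x : X) (y : Output K) : EuclideanSpace ℝ (Fin d) :=
  ∑ c ∈ C, f c x (c.restrict y)

/-- The linear score `θ(x, y) = θᵀ f(x, y)`. -/
def score (C : Finset (Finset (Fin ℓ))) (f : CliqueFeatures X K d)
    (θ : EuclideanSpace ℝ (Fin d)) (x : X) (y : Output K) : ℝ :=
  inner ℝ θ (featureMap C f x y)

/-- The maximum score `max_y θ(x, y)`. -/
def maxScore (C : Finset (Finset (Fin ℓ))) (f : CliqueFeatures X K d)
    (θ : EuclideanSpace ℝ (Fin d)) (x : X) : ℝ :=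
  ⨆ y : Output K, score C f θ x y

/-- The max-marginal of a clique assignment: the largest score `θ(x, y')` of an output `y'`
with `y'_c = y_c`. -/
def maxMarginal (C : Finset (Finset (Fin ℓ))) (f : CliqueFeatures X K d)
    (θ : EuclideanSpace ℝ (Fin d)) (x : X)
    (c : Finset (Fin ℓ)) (yc : CliqueAssignment K c) : ℝ :=
  ⨆ y : {y : Output K // c.restrict y = yc}, score C f θ x y.1

/-- The max-mean-max threshold `τ(x; θ, α)`. -/
def threshold (C : Finset (Finset (Fin ℓ))) (f : CliqueFeatures X K d) (α : ℝ)
    (θ : EuclideanSpace ℝ (Fin d)) (x : X) : ℝ :=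
  α * maxScore C f θ x +
    (1 - α) * (1 / (numAssignments K C : ℝ) *
      ∑ c ∈ C, ∑ yc : CliqueAssignment K c, maxMarginal C f θ x c yc)

/-- The filtering loss: the indicator of `θ(x, y) ≤ τ(x; θ, α)`. -/
def filteringLoss (C : Finset (Finset (Fin ℓ))) (f : CliqueFeatures X K d) (α : ℝ)
    (θ : EuclideanSpace ℝ (Fin d)) (x : X) (y : Output K) : ℝ :=
  if score C f θ x y ≤ threshold C f α θ x then 1 else 0

/-- The efficiency loss: the proportion of clique assignments whose max-marginal exceeds the
threshold. It does not depend on the output. -/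
def efficiencyLoss (C : Finset (Finset (Fin ℓ))) (f : CliqueFeatures X K d) (α : ℝ)
    (θ : EuclideanSpace ℝ (Fin d)) (x : X) (_y : Output K) : ℝ :=
  1 / (numAssignments K C : ℝ) *
    ∑ c ∈ C, ∑ yc : CliqueAssignment K c,
      if threshold C f α θ x < maxMarginal C f θ x c yc then 1 else 0

/-- The `γ`-margin function `r_γ`. -/
def ramp (γ z : ℝ) : ℝ :=
  if z < 0 then 1 else if z ≤ γ then 1 - z / γ else 0

/-- The margin-augmented filtering loss. -/
def marginFilteringLoss (C : Finset (Finset (Fin ℓ))) (f : CliqueFeatures X K d) (α γ : ℝ)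
    (θ : EuclideanSpace ℝ (Fin d)) (x : X) (y : Output K) : ℝ :=
  ramp γ (score C f θ x y - threshold C f α θ x)

/-- The margin-augmented efficiency loss. -/
def marginEfficiencyLoss (C : Finset (Finset (Fin ℓ))) (f : CliqueFeatures X K d) (α γ : ℝ)
    (θ : EuclideanSpace ℝ (Fin d)) (x : X) (_y : Output K) : ℝ :=
  1 / (numAssignments K C : ℝ) *
    ∑ c ∈ C, ∑ yc : CliqueAssignment K c,
      ramp γ (threshold C f α θ x - maxMarginal C f θ x c yc)

/-- The expectation of a loss under the joint distribution `D` of `(X, Y)`. -/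
def expectedLoss [MeasurableSpace X] (D : Measure (X × Output K))
    (loss : X → Output K → ℝ) : ℝ :=
  ∫ z, loss z.1 z.2 ∂D

/-- The empirical expectation of a loss on the sample `S`. -/
def empiricalLoss {n : ℕ} (S : Fin n → X × Output K) (loss : X → Output K → ℝ) : ℝ :=
  1 / (n : ℝ) * ∑ i, loss (S i).1 (S i).2

end SPC

end

/-! Each 0-1 type loss is dominated by its margin version, which takes values in [0, 1]. So it
suffices to bound, uniformly over the ball of radius B, the gap between the mean and the empirical
mean of the margin loss. The supremum of this gap concentrates by bounded differences; what remains
is its expectation.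

Index all clique assignments by k, with feature φ_k. Scores, max-marginals and the threshold all
change by at most ∑_k |⟨θ - θ', φ_k⟩| when θ is replaced by θ', so both margin losses are Lipschitz
for this quantity with constant L = 2/γ. No contraction in each max separately is needed.

The key is `integral_iSup_integral_sub_le`: for one observation and any additive offset,
symmetrization and contraction together replace the deviation process by the linear process 2Lm⟨θ,
εφ_k⟩, with ε a random sign and k a uniform random assignment. Averaging over k reproduces the sum
in the Lipschitz bound, at the price of the factor m. Because the offset is arbitrary,
`integral_iSup_sum_le_integral_iSup_sum` makes the exchange one observation at a time. The linear
process has expected supremum at most 2LmB√n, since a signed sum of n features of norm at most 1 has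
second moment at most n. Dividing by n gives 4mB/(γ√n); the factor √|𝒞| of the theorem is slack.

Suprema are first taken over finite families, where they are measurable and attained; a dense
sequence and continuity in θ give the whole ball. -/

/-! ### Product measures and the bounded difference inequality. -/

theorem integrable_of_measurable_of_abs_le {Ω : Type*} [MeasurableSpace Ω] {μ : Measure Ω}
    [IsFiniteMeasure μ] {f : Ω → ℝ} (hf : Measurable f) {M : ℝ} (hM : ∀ ω, |f ω| ≤ M) :
    Integrable f μ :=
  .of_bound hf.aestronglyMeasurable M (.of_forall hM)

theorem abs_integral_le_of_abs_le {Ω : Type*} [MeasurableSpace Ω] {μ : Measure Ω}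
    [IsProbabilityMeasure μ] {f : Ω → ℝ} {M : ℝ} (hM : ∀ ω, |f ω| ≤ M) : |∫ ω, f ω ∂μ| ≤ M := by
  simpa using norm_integral_le_of_norm_le_const (μ := μ) (f := f) (C := M) (.of_forall hM)

theorem measurable_fin_cons {Z : Type*} [MeasurableSpace Z] {n : ℕ} :
    Measurable fun p : Z × (Fin n → Z) => (Fin.cons p.1 p.2 : Fin (n + 1) → Z) := by
  refine measurable_pi_lambda _ fun i => ?_
  refine Fin.cases ?_ (fun j => ?_) i
  · simpa using measurable_fst
  · simpa using! (measurable_pi_apply j).comp measurable_snd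

theorem integral_pi_succ {Z : Type*} [MeasurableSpace Z] {μ : Measure Z} [IsProbabilityMeasure μ]
    {n : ℕ} {F : (Fin (n + 1) → Z) → ℝ} (hF : Measurable F) {M : ℝ} (hM : ∀ S, |F S| ≤ M) :
    ∫ S, F S ∂(Measure.pi fun _ => μ) =
      ∫ z, ∫ S : Fin n → Z, F (Fin.cons z S) ∂(Measure.pi fun _ => μ) ∂μ := by
  have h := (measurePreserving_piFinSuccAbove (fun _ : Fin (n + 1) => μ) 0).symm
  rw [← h.integral_comp' (g := F), integral_prod]
  · simp [MeasurableEquiv.piFinSuccAbove, Fin.insertNthEquiv]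
  · refine integrable_of_measurable_of_abs_le (hF.comp (MeasurableEquiv.measurable _)) fun p => hM _

theorem integrable_exp_mul_of_abs_le {Ω : Type*} [MeasurableSpace Ω] {μ : Measure Ω}
    [IsFiniteMeasure μ] {f : Ω → ℝ} (hf : Measurable f) {M : ℝ} (hM : ∀ ω, |f ω| ≤ M) (t : ℝ) :
    Integrable (fun ω => Real.exp (t * f ω)) μ := by
  refine integrable_of_measurable_of_abs_le (M := Real.exp (|t| * M)) (by fun_prop) fun ω => ?_
  rw [Real.abs_exp]
  refine Real.exp_le_exp.2 ((le_abs_self _).trans ?_)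
  rw [abs_mul]
  exact mul_le_mul_of_nonneg_left (hM ω) (abs_nonneg t)

/-- A bounded random variable whose values differ by at most `c` is subgaussian. -/
theorem integral_exp_sub_integral_le {Ω : Type*} [MeasurableSpace Ω] {μ : Measure Ω}
    [IsProbabilityMeasure μ] {f : Ω → ℝ} (hf : Measurable f) {c : ℝ}
    (hc : ∀ ω ω', |f ω - f ω'| ≤ c) (t : ℝ) :
    ∫ ω, Real.exp (t * (f ω - ∫ ω', f ω' ∂μ)) ∂μ ≤ Real.exp (c ^ 2 * t ^ 2 / 2) := by
  obtain ⟨ω₀⟩ := nonempty_of_isProbabilityMeasure μ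
  have hc0 : 0 ≤ c := (abs_nonneg _).trans (hc ω₀ ω₀)
  -- An interval centred at one value of `f` has width 2c, not c. This loses a factor 4 in the
  -- exponent, which the constant 8 of the theorem can afford.
  have h := (ProbabilityTheory.hasSubgaussianMGF_of_mem_Icc (μ := μ) (X := f)
    (a := f ω₀ - c) (b := f ω₀ + c) hf.aemeasurable (.of_forall fun ω => by
      have := abs_le.1 (hc ω ω₀); constructor <;> linarith)).mgf_le t
  simp only [ProbabilityTheory.mgf] at h
  refine h.trans (le_of_eq ?_)
  congr 3
  simp only [NNReal.coe_pow, NNReal.coe_div, coe_nnnorm, NNReal.coe_ofNat, Real.norm_eq_abs]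
  rw [show f ω₀ + c - (f ω₀ - c) = 2 * c by ring, abs_of_nonneg (by positivity)]
  ring

/-- The bounded difference inequality (McDiarmid) for the moment generating function. -/
theorem integral_exp_sub_integral_le_of_boundedDifferences {Z : Type*} [MeasurableSpace Z]
    {μ : Measure Z} [IsProbabilityMeasure μ] {c M : ℝ} (t : ℝ) {n : ℕ} {F : (Fin n → Z) → ℝ}
    (hF : Measurable F) (hM : ∀ S, |F S| ≤ M)
    (hc : ∀ S i z, |F (Function.update S i z) - F S| ≤ c) :
    ∫ S, Real.exp (t * (F S - ∫ S', F S' ∂(Measure.pi fun _ => μ))) ∂(Measure.pi fun _ => μ) ≤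
      Real.exp (n * (c ^ 2 * t ^ 2 / 2)) := by
  induction n with
  | zero =>
    have h (S : Fin 0 → Z) : F S = F Fin.elim0 := congrArg F (Subsingleton.elim _ _)
    simp [h]
  | succ n ih =>
    have hcons (z : Z) : Measurable fun S : Fin n → Z => (Fin.cons z S : Fin (n + 1) → Z) :=
      measurable_fin_cons.comp measurable_prodMk_left
    -- The first step of the Doob martingale: the conditional mean given the first coordinate. It
    -- inherits the oscillation bound c.
    set ψ : Z → ℝ := fun z => ∫ S : Fin n → Z, F (Fin.cons z S) ∂(Measure.pi fun _ => μ) with hψ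
    have hψm : Measurable ψ :=
      (hF.comp measurable_fin_cons).stronglyMeasurable.integral_prod_right'.measurable
    have hψM (z : Z) : |ψ z| ≤ M := abs_integral_le_of_abs_le fun S => hM _
    have hint (z : Z) : Integrable (fun S : Fin n → Z => F (Fin.cons z S))
        (Measure.pi fun _ => μ) :=
      integrable_of_measurable_of_abs_le (hF.comp (hcons z)) fun S => hM _
    have hψc (z z' : Z) : |ψ z - ψ z'| ≤ c := by
      rw [hψ]
      simp only
      rw [← integral_sub (hint z) (hint z')]
      refine abs_integral_le_of_abs_le fun S => ?_
      have := hc (Fin.cons z' S) 0 z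
      rwa [Fin.update_cons_zero] at this
    set e : ℝ := ∫ S', F S' ∂(Measure.pi fun _ => μ) with he
    have hee : e = ∫ z, ψ z ∂μ := integral_pi_succ hF hM
    have heM : |e| ≤ M := abs_integral_le_of_abs_le hM
    have hbd (S) : |F S - e| ≤ M + M := (abs_sub _ _).trans (add_le_add (hM S) heM)
    have hbde (S) : |Real.exp (t * (F S - e))| ≤ Real.exp (|t| * (M + M)) := by
      rw [Real.abs_exp]
      refine Real.exp_le_exp.2 ((le_abs_self _).trans ?_)
      rw [abs_mul]
      exact mul_le_mul_of_nonneg_left (hbd S) (abs_nonneg t)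
    rw [integral_pi_succ (by fun_prop) hbde]
    have step (z : Z) : ∫ S : Fin n → Z, Real.exp (t * (F (Fin.cons z S) - e))
        ∂(Measure.pi fun _ => μ) ≤
        Real.exp (n * (c ^ 2 * t ^ 2 / 2)) * Real.exp (t * (ψ z - ∫ z', ψ z' ∂μ)) := by
      have h1 := ih (F := fun S => F (Fin.cons z S)) (hF.comp (hcons z)) (fun S => hM _)
        (fun S i w => by rw [Fin.cons_update]; exact hc _ _ _)
      have h2 (S : Fin n → Z) : Real.exp (t * (F (Fin.cons z S) - e)) =
          Real.exp (t * (F (Fin.cons z S) - ψ z)) * Real.exp (t * (ψ z - e)) := by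
        rw [← Real.exp_add]; ring_nf
      simp_rw [h2]
      rw [integral_mul_const, ← hee]
      exact mul_le_mul_of_nonneg_right h1 (Real.exp_pos _).le
    calc _ ≤ ∫ z, Real.exp (n * (c ^ 2 * t ^ 2 / 2)) *
            Real.exp (t * (ψ z - ∫ z', ψ z' ∂μ)) ∂μ := by
          refine integral_mono ?_ ?_ step
          · refine integrable_of_measurable_of_abs_le (M := Real.exp (|t| * (M + M))) ?_
              fun z => abs_integral_le_of_abs_le fun S => hbde _
            have hm : Measurable fun p : Z × (Fin n → Z) =>
                Real.exp (t * (F (Fin.cons p.1 p.2) - e)) := by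
              exact Real.measurable_exp.comp
                (((hF.comp measurable_fin_cons).sub_const e).const_mul t)
            exact hm.stronglyMeasurable.integral_prod_right'.measurable
          · refine Integrable.const_mul ?_ _
            rw [← hee]
            exact integrable_exp_mul_of_abs_le (M := M + M) (by fun_prop)
              (fun z => (abs_sub _ _).trans (add_le_add (hψM z) heM)) t
      _ ≤ Real.exp (n * (c ^ 2 * t ^ 2 / 2)) * Real.exp (c ^ 2 * t ^ 2 / 2) := by
          rw [integral_const_mul]
          exact mul_le_mul_of_nonneg_left (integral_exp_sub_integral_le hψm hψc t)
            (Real.exp_pos _).le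
      _ = _ := by rw [← Real.exp_add]; push_cast; ring_nf

/-- The one-sided tail form of the bounded difference inequality, with differences `1 / n`. -/
theorem measureReal_integral_add_le_of_boundedDifferences {Z : Type*} [MeasurableSpace Z]
    {μ : Measure Z} [IsProbabilityMeasure μ] {M : ℝ} {n : ℕ} (hn : 1 ≤ n) {F : (Fin n → Z) → ℝ}
    (hF : Measurable F) (hM : ∀ S, |F S| ≤ M)
    (hc : ∀ S i z, |F (Function.update S i z) - F S| ≤ 1 / n) {s : ℝ} (hs : 0 ≤ s) :
    (Measure.pi fun _ => μ).real {S | ∫ S', F S' ∂(Measure.pi fun _ => μ) + s ≤ F S} ≤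
      Real.exp (-(n * s ^ 2 / 2)) := by
  have hn0 : (0 : ℝ) < n := by exact_mod_cast hn
  set e : ℝ := ∫ S', F S' ∂(Measure.pi fun _ => μ) with he
  -- The variance proxy is n · (1/n)² = 1/n.
  have hsub : ProbabilityTheory.HasSubgaussianMGF (fun S => F S - e) ((n : NNReal)⁻¹)
      (Measure.pi fun _ => μ) := by
    refine ⟨fun t => integrable_exp_mul_of_abs_le (M := M + M) (by fun_prop)
      (fun S => (abs_sub _ _).trans (add_le_add (hM S) (abs_integral_le_of_abs_le hM))) t,
      fun t => ?_⟩
    refine (integral_exp_sub_integral_le_of_boundedDifferences t hF hM hc).trans (le_of_eq ?_)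
    congr 1
    push_cast
    field_simp
  have h := hsub.measure_ge_le hs
  have hset : {S | e + s ≤ F S} = {S | s ≤ F S - e} := by
    ext S; simp only [Set.mem_ofPred_eq]; constructor <;> intro _ <;> linarith
  rw [hset]
  refine h.trans (le_of_eq ?_)
  congr 1
  push_cast
  field_simp

/-! ### Suprema of finite families of random variables. -/

theorem le_iSup_of_finite {T : Type*} [Finite T] (x : T → ℝ) (t : T) : x t ≤ ⨆ t, x t :=
  le_ciSup (Set.finite_range x).bddAbove t

theorem exists_forall_abs_le {T : Type*} [Finite T] (x : T → ℝ) : ∃ M, ∀ t, |x t| ≤ M :=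
  ⟨⨆ t, |x t|, le_iSup_of_finite _⟩

section FiniteSupremum

variable {T : Type*} [Finite T] [Nonempty T]

theorem abs_iSup_le_of_abs_le {x : T → ℝ} {M : ℝ} (h : ∀ t, |x t| ≤ M) : |⨆ t, x t| ≤ M := by
  obtain ⟨t, ht⟩ := exists_eq_ciSup_of_finite (f := x)
  exact ht ▸ h t

theorem iSup_le_iSup_add {x y : T → ℝ} {c : ℝ} (h : ∀ t, x t ≤ y t + c) :
    ⨆ t, x t ≤ (⨆ t, y t) + c :=
  ciSup_le fun t => (h t).trans (add_le_add_left (le_iSup_of_finite y t) c)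

theorem abs_iSup_sub_iSup_le {x y : T → ℝ} {c : ℝ} (h : ∀ t, |x t - y t| ≤ c) :
    |(⨆ t, x t) - ⨆ t, y t| ≤ c := by
  have h1 := iSup_le_iSup_add fun t => (sub_le_iff_le_add'.1 (abs_le.1 (h t)).2)
  have h2 : ⨆ t, y t ≤ (⨆ t, x t) + c :=
    iSup_le_iSup_add fun t => by linarith [(abs_le.1 (h t)).1]
  exact abs_le.2 ⟨by linarith, by linarith⟩

/-- A comparison between expected suprema of one random process and another, valid for every
additive offset, passes to sums of independent copies. -/
theorem integral_iSup_sum_le_integral_iSup_sum {Z W : Type*} [MeasurableSpace Z]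
    [MeasurableSpace W] {μ : Measure Z} [IsProbabilityMeasure μ] {ν : Measure W}
    [IsProbabilityMeasure ν] {a : T → Z → ℝ} {b : T → W → ℝ} (ha : ∀ t, Measurable (a t))
    (hb : ∀ t, Measurable (b t)) {α β : ℝ} (hα : ∀ t z, |a t z| ≤ α) (hβ : ∀ t w, |b t w| ≤ β)
    (h : ∀ A : T → ℝ, ∫ z, ⨆ t, (A t + a t z) ∂μ ≤ ∫ w, ⨆ t, (A t + b t w) ∂ν)
    (n : ℕ) (A : T → ℝ) :
    ∫ S : Fin n → Z, ⨆ t, (A t + ∑ i, a t (S i)) ∂(Measure.pi fun _ => μ) ≤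
      ∫ S : Fin n → W, ⨆ t, (A t + ∑ i, b t (S i)) ∂(Measure.pi fun _ => ν) := by
  induction n generalizing A with
  | zero => simp
  | succ n ih =>
    obtain ⟨M, hM⟩ := exists_forall_abs_le A
    have hsa (k : ℕ) (S : Fin k → Z) (t : T) : |∑ i, a t (S i)| ≤ k * α :=
      (Finset.abs_sum_le_sum_abs _ _).trans
        ((Finset.sum_le_sum fun i _ => hα t (S i)).trans (by simp))
    have hsb (k : ℕ) (S : Fin k → W) (t : T) : |∑ i, b t (S i)| ≤ k * β :=
      (Finset.abs_sum_le_sum_abs _ _).trans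
        ((Finset.sum_le_sum fun i _ => hβ t (S i)).trans (by simp))
    have hmix : Integrable (fun p : Z × (Fin n → W) =>
        ⨆ t, (A t + a t p.1 + ∑ i, b t (p.2 i))) (μ.prod (Measure.pi fun _ => ν)) := by
      refine integrable_of_measurable_of_abs_le (M := M + α + n * β)
        (Measurable.iSup fun t => by fun_prop) fun p => abs_iSup_le_of_abs_le fun t => ?_
      exact (abs_add_le _ _).trans (add_le_add ((abs_add_le _ _).trans
        (add_le_add (hM t) (hα t _))) (hsb n _ t))
    have hmix' : Integrable (fun p : W × (Fin n → W) =>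
        ⨆ t, (A t + b t p.1 + ∑ i, b t (p.2 i))) (ν.prod (Measure.pi fun _ => ν)) := by
      refine integrable_of_measurable_of_abs_le (M := M + β + n * β)
        (Measurable.iSup fun t => by fun_prop) fun p => abs_iSup_le_of_abs_le fun t => ?_
      exact (abs_add_le _ _).trans (add_le_add ((abs_add_le _ _).trans
        (add_le_add (hM t) (hβ t _))) (hsb n _ t))
    have hall : Integrable (fun p : Z × (Fin n → Z) =>
        ⨆ t, (A t + a t p.1 + ∑ i, a t (p.2 i))) (μ.prod (Measure.pi fun _ => μ)) := by
      refine integrable_of_measurable_of_abs_le (M := M + α + n * α)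
        (Measurable.iSup fun t => by fun_prop) fun p => abs_iSup_le_of_abs_le fun t => ?_
      exact (abs_add_le _ _).trans (add_le_add ((abs_add_le _ _).trans
        (add_le_add (hM t) (hα t _))) (hsa n _ t))
    rw [integral_pi_succ (M := M + (n + 1 : ℕ) * α) (Measurable.iSup fun t => by fun_prop)
        fun S => abs_iSup_le_of_abs_le fun t =>
          (abs_add_le _ _).trans (add_le_add (hM t) (hsa _ S t)),
      integral_pi_succ (M := M + (n + 1 : ℕ) * β) (Measurable.iSup fun t => by fun_prop)
        fun S => abs_iSup_le_of_abs_le fun t =>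
          (abs_add_le _ _).trans (add_le_add (hM t) (hsb _ S t))]
    simp only [Fin.sum_univ_succ, Fin.cons_zero, Fin.cons_succ, ← add_assoc]
    -- With the first observation frozen into the offset, induction exchanges the others; after
    -- Fubini these are frozen in turn and the one-observation hypothesis exchanges the first.
    calc ∫ z, ∫ S : Fin n → Z, ⨆ t, (A t + a t z + ∑ i, a t (S i)) ∂(Measure.pi fun _ => μ) ∂μ
        ≤ ∫ z, ∫ S : Fin n → W, ⨆ t, (A t + a t z + ∑ i, b t (S i))
            ∂(Measure.pi fun _ => ν) ∂μ :=
          integral_mono hall.integral_prod_left hmix.integral_prod_left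
            fun z => ih fun t => A t + a t z
      _ = ∫ S : Fin n → W, ∫ z, ⨆ t, (A t + a t z + ∑ i, b t (S i)) ∂μ
            ∂(Measure.pi fun _ => ν) := integral_integral_swap hmix
      _ ≤ ∫ S : Fin n → W, ∫ w, ⨆ t, (A t + b t w + ∑ i, b t (S i)) ∂ν
            ∂(Measure.pi fun _ => ν) := by
          refine integral_mono hmix.integral_prod_right hmix'.integral_prod_right fun S => ?_
          simp only [add_right_comm _ _ (∑ i, b _ (S i))]
          exact h fun t => A t + ∑ i, b t (S i)
      _ = _ := (integral_integral_swap hmix').symm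

/-- Finite-class uniform deviation: the failure probability of the bound given by the expected
supremum of the deviations. -/
theorem measureReal_exists_deviation_le {Z : Type*} [MeasurableSpace Z] {μ : Measure Z}
    [IsProbabilityMeasure μ] {g : T → Z → ℝ} (hg : ∀ t, Measurable (g t))
    (hg01 : ∀ t z, g t z ∈ Set.Icc (0 : ℝ) 1) {n : ℕ} (hn : 1 ≤ n) {R s : ℝ} (hs : 0 ≤ s)
    (hR : ∫ S : Fin n → Z, ⨆ t, (0 + ∑ i, (∫ z, g t z ∂μ - g t (S i)))
      ∂(Measure.pi fun _ => μ) ≤ n * R) :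
    (Measure.pi fun _ => μ).real
      {S : Fin n → Z | ∃ t, 1 / (n : ℝ) * ∑ i, g t (S i) + R + s < ∫ z, g t z ∂μ} ≤
      Real.exp (-(n * s ^ 2 / 2)) := by
  have hn0 : (0 : ℝ) < n := by exact_mod_cast hn
  set F : (Fin n → Z) → ℝ := fun S => ⨆ t, (∫ z, g t z ∂μ - 1 / (n : ℝ) * ∑ i, g t (S i)) with hF
  have hFR : ∫ S, F S ∂(Measure.pi fun _ => μ) ≤ R := by
    have h (S : Fin n → Z) : F S =
        1 / (n : ℝ) * ⨆ t, (0 + ∑ i, (∫ z, g t z ∂μ - g t (S i))) := by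
      rw [Real.mul_iSup_of_nonneg (by positivity)]
      refine iSup_congr fun t => ?_
      simp only [Finset.sum_sub_distrib, Finset.sum_const, Finset.card_univ, Fintype.card_fin,
        nsmul_eq_mul]
      field_simp
      ring
    simp_rw [h]
    rw [integral_const_mul]
    calc _ ≤ 1 / (n : ℝ) * (n * R) := mul_le_mul_of_nonneg_left hR (by positivity)
      _ = R := by field_simp
  have habs (t : T) (z : Z) : |g t z| ≤ 1 := abs_le.2 ⟨by linarith [(hg01 t z).1], (hg01 t z).2⟩
  have hFM (S) : |F S| ≤ 1 + 1 := by
    refine abs_iSup_le_of_abs_le fun t => (abs_sub _ _).trans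
      (add_le_add (abs_integral_le_of_abs_le (habs t)) ?_)
    rw [abs_mul, abs_of_nonneg (by positivity)]
    calc _ ≤ 1 / (n : ℝ) * n := by
          refine mul_le_mul_of_nonneg_left ?_ (by positivity)
          exact (Finset.abs_sum_le_sum_abs _ _).trans
            ((Finset.sum_le_sum fun i _ => habs t (S i)).trans (by simp))
      _ = 1 := by field_simp
  -- One summand moves within [0, 1], and a supremum is 1-Lipschitz in the uniform norm.
  have hFc (S : Fin n → Z) (i : Fin n) (z : Z) : |F (Function.update S i z) - F S| ≤ 1 / n := by
    refine abs_iSup_sub_iSup_le fun t => ?_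
    have h : ∑ j, g t (Function.update S i z j) = ∑ j, g t (S j) + (g t z - g t (S i)) := by
      rw [← sub_eq_iff_eq_add', ← Finset.sum_sub_distrib, Finset.sum_eq_single i]
      · simp
      · intro j _ hj; simp [hj]
      · simp
    rw [h, show ∀ x y w : ℝ, x - 1 / n * (y + w) - (x - 1 / n * y) = 1 / n * (-w) by
      intros; ring, abs_mul, abs_of_nonneg (by positivity : (0 : ℝ) ≤ 1 / n), abs_neg]
    refine mul_le_of_le_one_right (by positivity) (abs_le.2 ⟨?_, ?_⟩) <;>
      linarith [(hg01 t z).1, (hg01 t z).2, (hg01 t (S i)).1, (hg01 t (S i)).2]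
  refine (measureReal_mono ?_).trans (measureReal_integral_add_le_of_boundedDifferences hn
    (Measurable.iSup fun t => by fun_prop) hFM hFc hs)
  rintro S ⟨t, ht⟩
  have := le_iSup_of_finite (fun t => ∫ z, g t z ∂μ - 1 / (n : ℝ) * ∑ i, g t (S i)) t
  change _ ≤ F S at this
  change _ ≤ F S
  linarith

end FiniteSupremum

/-! ### Symmetrization, contraction and uniform deviation over a ball. -/

/-- The feature selected by the index, multiplied by the sign. -/
def signedFeature {Z κ F : Type*} [Neg F] (φ : κ → Z → F) (w : Z × (Bool × κ)) : F :=
  cond w.2.1 (φ w.2.2 w.1) (-φ w.2.2 w.1)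

theorem norm_signedFeature_le {Z κ F : Type*} [NormedAddCommGroup F] {φ : κ → Z → F}
    (hφ1 : ∀ k z, ‖φ k z‖ ≤ 1) (w : Z × (Bool × κ)) : ‖signedFeature φ w‖ ≤ 1 := by
  obtain ⟨z, ε, k⟩ := w
  cases ε <;> simpa [signedFeature] using hφ1 k z

theorem measurable_signedFeature {Z κ F : Type*} [MeasurableSpace Z] [Countable κ]
    [MeasurableSpace κ] [DiscreteMeasurableSpace κ] [Neg F] [MeasurableSpace F] [MeasurableNeg F]
    {φ : κ → Z → F} (hφ : ∀ k, Measurable (φ k)) : Measurable (signedFeature φ) := by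
  refine measurable_from_prod_countable_left fun ⟨ε, k⟩ => ?_
  cases ε
  · exact (hφ k).neg
  · exact hφ k

section Rademacher

variable {Z : Type*} [MeasurableSpace Z] {κ : Type*} [Fintype κ] [Nonempty κ] [MeasurableSpace κ]
  [DiscreteMeasurableSpace κ] {F : Type*} [NormedAddCommGroup F] [InnerProductSpace ℝ F]

/-- The law of a point together with an independent uniform sign and a uniform index. -/
noncomputable def signIndexMeasure (μ : Measure Z) (κ : Type*) [Fintype κ] [Nonempty κ]
    [MeasurableSpace κ] : Measure (Z × (Bool × κ)) :=
  μ.prod (PMF.uniformOfFintype (Bool × κ)).toMeasure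

instance (μ : Measure Z) [IsProbabilityMeasure μ] :
    IsProbabilityMeasure (signIndexMeasure μ κ) := by
  unfold signIndexMeasure; infer_instance

theorem integral_signIndexMeasure {μ : Measure Z} [IsProbabilityMeasure μ]
    {h : Z × (Bool × κ) → ℝ} (hm : Measurable h) {M : ℝ} (hM : ∀ w, |h w| ≤ M) :
    ∫ w, h w ∂(signIndexMeasure μ κ) = ∫ z, (2 * (Fintype.card κ : ℝ))⁻¹ *
      ∑ k, (h (z, true, k) + h (z, false, k)) ∂μ := by
  rw [signIndexMeasure, integral_prod _ (integrable_of_measurable_of_abs_le hm hM)]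
  refine integral_congr_ae (.of_forall fun z => ?_)
  simp only [PMF.integral_eq_sum, PMF.uniformOfFintype_apply, Fintype.sum_prod_type,
    Fintype.sum_bool, Finset.sum_add_distrib, smul_eq_mul, ← Finset.mul_sum]
  simp

variable [MeasurableSpace F] [BorelSpace F] [SecondCountableTopology F]

/-- The squared norm of a random signed sum of features has expectation at most the number of
summands. -/
theorem integral_norm_sq_sum_signedFeature_le {μ : Measure Z} [IsProbabilityMeasure μ]
    {φ : κ → Z → F} (hφ : ∀ k, Measurable (φ k)) (hφ1 : ∀ k z, ‖φ k z‖ ≤ 1) (n : ℕ) (a : F) :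
    ∫ S : Fin n → Z × (Bool × κ), ‖a + ∑ i, signedFeature φ (S i)‖ ^ 2
      ∂(Measure.pi fun _ => signIndexMeasure μ κ) ≤ ‖a‖ ^ 2 + n := by
  have hum := measurable_signedFeature hφ
  have hbd (k : ℕ) (a : F) (S : Fin k → Z × (Bool × κ)) :
      |‖a + ∑ i, signedFeature φ (S i)‖ ^ 2| ≤ (‖a‖ + k) ^ 2 := by
    rw [abs_of_nonneg (by positivity)]
    refine pow_le_pow_left₀ (norm_nonneg _) ((norm_add_le _ _).trans ?_) 2
    gcongr
    exact (norm_sum_le _ _).trans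
      ((Finset.sum_le_sum fun i _ => norm_signedFeature_le hφ1 (S i)).trans (by simp))
  have hone (a : F) : ∫ w, ‖a + signedFeature φ w‖ ^ 2 ∂(signIndexMeasure μ κ) ≤
      ‖a‖ ^ 2 + 1 := by
    rw [integral_signIndexMeasure (M := (‖a‖ + 1) ^ 2) (by fun_prop) fun w => by
      simpa using! hbd 1 a fun _ => w]
    refine (le_abs_self _).trans (abs_integral_le_of_abs_le fun z => ?_)
    rw [abs_of_nonneg (by positivity), inv_mul_le_iff₀ (by positivity)]
    -- The cross terms of the two signs cancel for each index.
    calc _ ≤ ∑ k : κ, 2 * (‖a‖ ^ 2 + 1) := by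
          refine Finset.sum_le_sum fun k _ => ?_
          have h : ‖φ k z‖ ^ 2 ≤ 1 := pow_le_one₀ (norm_nonneg _) (hφ1 k z)
          simp only [signedFeature, cond_true, cond_false, norm_add_sq_real, inner_neg_right,
            norm_neg]
          linarith
      _ = _ := by simp; ring
  induction n generalizing a with
  | zero => simp
  | succ n ih =>
    rw [integral_pi_succ (by fun_prop) (hbd _ a)]
    simp only [Fin.sum_univ_succ, Fin.cons_zero, Fin.cons_succ, ← add_assoc]
    have hint : Integrable (fun w => ‖a + signedFeature φ w‖ ^ 2) (signIndexMeasure μ κ) :=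
      integrable_of_measurable_of_abs_le (M := (‖a‖ + 1) ^ 2) (by fun_prop) fun w => by
        simpa using! hbd 1 a fun _ => w
    have hprod : Integrable (fun p : (Z × (Bool × κ)) × (Fin n → Z × (Bool × κ)) =>
        ‖a + signedFeature φ p.1 + ∑ i, signedFeature φ (p.2 i)‖ ^ 2)
        ((signIndexMeasure μ κ).prod (Measure.pi fun _ => signIndexMeasure μ κ)) := by
      refine integrable_of_measurable_of_abs_le (M := (‖a‖ + (n + 1 : ℕ)) ^ 2) (by fun_prop)
        fun p => ?_
      simpa [Fin.sum_univ_succ, ← add_assoc] using hbd (n + 1) a (Fin.cons p.1 p.2)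
    calc _ ≤ ∫ w, (‖a + signedFeature φ w‖ ^ 2 + n) ∂(signIndexMeasure μ κ) :=
          integral_mono hprod.integral_prod_left (hint.add (integrable_const _)) fun w =>
            ih (a + signedFeature φ w)
      _ ≤ ‖a‖ ^ 2 + 1 + n := by
          rw [integral_add hint (integrable_const _)]
          simpa using hone a
      _ = _ := by push_cast; ring

/-- The expected supremum of a signed linear process over a ball of radius `B`. -/
theorem integral_iSup_inner_signedFeature_le {μ : Measure Z} [IsProbabilityMeasure μ]
    {T : Type*} [Finite T] [Nonempty T] {θ : T → F} {B c : ℝ} (hθ : ∀ t, ‖θ t‖ ≤ B)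
    (hc : 0 ≤ c) {φ : κ → Z → F} (hφ : ∀ k, Measurable (φ k)) (hφ1 : ∀ k z, ‖φ k z‖ ≤ 1)
    {n : ℕ} (hn : 1 ≤ n) :
    ∫ S : Fin n → Z × (Bool × κ), ⨆ t, (0 + ∑ i, c * inner ℝ (θ t) (signedFeature φ (S i)))
      ∂(Measure.pi fun _ => signIndexMeasure μ κ) ≤ c * B * √n := by
  have hum := measurable_signedFeature hφ
  have hn0 : (0 : ℝ) < n := by exact_mod_cast hn
  have hs : 0 < √(n : ℝ) := Real.sqrt_pos.2 hn0
  have hB : 0 ≤ B := (norm_nonneg _).trans (hθ (Classical.arbitrary T))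
  have hsum (S : Fin n → Z × (Bool × κ)) : ‖∑ i, signedFeature φ (S i)‖ ≤ n :=
    (norm_sum_le _ _).trans
      ((Finset.sum_le_sum fun i _ => norm_signedFeature_le hφ1 (S i)).trans (by simp))
  -- Cauchy–Schwarz, then u ≤ (u²/√n + √n)/2: this takes the place of Jensen, so only the second
  -- moment is needed.
  have hpt (S : Fin n → Z × (Bool × κ)) :
      ⨆ t, (0 + ∑ i, c * inner ℝ (θ t) (signedFeature φ (S i))) ≤
        c * B * ((‖∑ i, signedFeature φ (S i)‖ ^ 2 / √n + √n) / 2) := by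
    refine ciSup_le fun t => ?_
    rw [zero_add, ← Finset.mul_sum, ← inner_sum, mul_assoc]
    refine mul_le_mul_of_nonneg_left ((real_inner_le_norm _ _).trans ?_) hc
    refine mul_le_mul (hθ t) ?_ (norm_nonneg _) hB
    have h := sq_nonneg (‖∑ i, signedFeature φ (S i)‖ - √n)
    have h2 : ‖∑ i, signedFeature φ (S i)‖ ^ 2 / √n + √n =
        (‖∑ i, signedFeature φ (S i)‖ ^ 2 + √n ^ 2) / √n := by field_simp
    rw [le_div_iff₀ two_pos, h2, le_div_iff₀ hs]
    nlinarith
  have hint : Integrable (fun S : Fin n → Z × (Bool × κ) =>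
      ‖∑ i, signedFeature φ (S i)‖ ^ 2) (Measure.pi fun _ => signIndexMeasure μ κ) :=
    integrable_of_measurable_of_abs_le (M := (n : ℝ) ^ 2) (by fun_prop) fun S => by
      rw [abs_of_nonneg (by positivity)]
      exact pow_le_pow_left₀ (norm_nonneg _) (hsum S) 2
  have hsq := integral_norm_sq_sum_signedFeature_le (μ := μ) hφ hφ1 n 0
  simp only [zero_add, norm_zero, ne_eq, OfNat.ofNat_ne_zero, not_false_eq_true, zero_pow] at hsq
  calc _ ≤ ∫ S : Fin n → Z × (Bool × κ),
        c * B * ((‖∑ i, signedFeature φ (S i)‖ ^ 2 / √n + √n) / 2)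
        ∂(Measure.pi fun _ => signIndexMeasure μ κ) := by
        refine integral_mono ?_ ?_ hpt
        · refine integrable_of_measurable_of_abs_le (M := c * (B * n))
            (Measurable.iSup fun t => by fun_prop) fun S => abs_iSup_le_of_abs_le fun t => ?_
          rw [zero_add, ← Finset.mul_sum, ← inner_sum, abs_mul, abs_of_nonneg hc]
          refine mul_le_mul_of_nonneg_left ((abs_real_inner_le_norm _ _).trans ?_) hc
          exact mul_le_mul (hθ t) (hsum S) (norm_nonneg _) hB
        · exact (((hint.div_const _).add (integrable_const _)).div_const _).const_mul _
    _ = c * B * (((∫ S : Fin n → Z × (Bool × κ), ‖∑ i, signedFeature φ (S i)‖ ^ 2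
        ∂(Measure.pi fun _ => signIndexMeasure μ κ)) / √n + √n) / 2) := by
        rw [integral_const_mul, integral_div, integral_add (hint.div_const _)
          (integrable_const _), integral_div]
        simp
    _ ≤ c * B * ((n / √n + √n) / 2) := by gcongr
    _ = c * B * √n := by rw [Real.div_sqrt]; ring

/-- Symmetrization and contraction for one observation: deviations of functions that are Lipschitz
with respect to the sum of the absolute feature scores are dominated by the signed linear
process. -/
theorem integral_iSup_integral_sub_le {μ : Measure Z} [IsProbabilityMeasure μ]
    {T : Type*} [Finite T] [Nonempty T] {θ : T → F} {L : ℝ} {g : T → Z → ℝ}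
    (hg : ∀ t, Measurable (g t)) (hg01 : ∀ t z, g t z ∈ Set.Icc (0 : ℝ) 1)
    {φ : κ → Z → F} (hφ : ∀ k, Measurable (φ k)) (hφ1 : ∀ k z, ‖φ k z‖ ≤ 1) (hL0 : 0 ≤ L)
    (hL : ∀ s t z, g t z - g s z ≤ L * ∑ k, |inner ℝ (θ t - θ s) (φ k z)|) (A : T → ℝ) :
    ∫ z, ⨆ t, (A t + (∫ z', g t z' ∂μ - g t z)) ∂μ ≤
      ∫ w, ⨆ t, (A t + 2 * L * Fintype.card κ * inner ℝ (θ t) (signedFeature φ w))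
        ∂(signIndexMeasure μ κ) := by
  have hum := measurable_signedFeature hφ
  have hκ : (0 : ℝ) < Fintype.card κ := by exact_mod_cast Fintype.card_pos
  obtain ⟨M, hM⟩ := exists_forall_abs_le A
  obtain ⟨B, hB⟩ := exists_forall_abs_le fun t => ‖θ t‖
  simp only [abs_norm] at hB
  have habs (t : T) (z : Z) : |g t z| ≤ 1 := abs_le.2 ⟨by linarith [(hg01 t z).1], (hg01 t z).2⟩
  set c : ℝ := 2 * L * Fintype.card κ with hcdef
  have hc : 0 ≤ c := by positivity
  have hI1 : Integrable (fun z => ⨆ t, (A t + 2 * g t z)) μ :=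
    integrable_of_measurable_of_abs_le (M := M + 2) (Measurable.iSup fun t => by fun_prop)
      fun z => abs_iSup_le_of_abs_le fun t => (abs_add_le _ _).trans
        (add_le_add (hM t) (by rw [abs_mul, abs_two]; linarith [habs t z]))
  have hI2 : Integrable (fun z => ⨆ t, (A t - 2 * g t z)) μ :=
    integrable_of_measurable_of_abs_le (M := M + 2) (Measurable.iSup fun t => by fun_prop)
      fun z => abs_iSup_le_of_abs_le fun t => (abs_sub _ _).trans
        (add_le_add (hM t) (by rw [abs_mul, abs_two]; linarith [habs t z]))
  have hI3 : Integrable (fun z => ⨆ t, (A t + (∫ z', g t z' ∂μ - g t z))) μ :=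
    integrable_of_measurable_of_abs_le (M := M + (1 + 1)) (Measurable.iSup fun t => by fun_prop)
      fun z => abs_iSup_le_of_abs_le fun t => (abs_add_le _ _).trans
        (add_le_add (hM t) ((abs_sub _ _).trans
          (add_le_add (abs_integral_le_of_abs_le (habs t)) (habs t z))))
  -- Half of the offset goes with the mean and half with the observation. Both suprema then depend
  -- on a single point, and after integration they share the same point, so no ghost sample is kept.
  have hsym (z : Z) : ⨆ t, (A t + (∫ z', g t z' ∂μ - g t z)) ≤
      (∫ z', ⨆ t, (A t + 2 * g t z') ∂μ + ⨆ t, (A t - 2 * g t z)) / 2 := by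
    refine ciSup_le fun t => ?_
    have h1 : A t + 2 * ∫ z', g t z' ∂μ ≤ ∫ z', ⨆ t, (A t + 2 * g t z') ∂μ := by
      have hgi : Integrable (fun z' => 2 * g t z') μ :=
        (integrable_of_measurable_of_abs_le (hg t) (habs t)).const_mul 2
      have : A t + 2 * ∫ z', g t z' ∂μ = ∫ z', (A t + 2 * g t z') ∂μ := by
        rw [integral_add (integrable_const _) hgi, integral_const_mul]; simp
      rw [this]
      exact integral_mono ((integrable_const _).add hgi) hI1
        fun z' => le_iSup_of_finite (fun t => A t + 2 * g t z') t
    have h2 := le_iSup_of_finite (fun t => A t - 2 * g t z) t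
    linarith
  have hw (w : Z × (Bool × κ)) : |⨆ t, (A t + c * inner ℝ (θ t) (signedFeature φ w))| ≤
      M + c * (B * 1) := by
    refine abs_iSup_le_of_abs_le fun t => (abs_add_le _ _).trans (add_le_add (hM t) ?_)
    rw [abs_mul, abs_of_nonneg hc]
    refine mul_le_mul_of_nonneg_left ((abs_real_inner_le_norm _ _).trans ?_) hc
    exact mul_le_mul (hB t) (norm_signedFeature_le hφ1 w) (norm_nonneg _)
      ((norm_nonneg _).trans (hB t))
  have hwm : Measurable fun w => ⨆ t, (A t + c * inner ℝ (θ t) (signedFeature φ w)) :=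
    Measurable.iSup fun t => by fun_prop
  -- Take maximizers t and s on the left; the Lipschitz bound turns g t - g s into a sum of absolute
  -- values over k. The average over k and signs carries the factor 1/(2|κ|), which fixes c = 2L|κ|.
  have hcontr (z : Z) : ((⨆ t, (A t + 2 * g t z)) + ⨆ t, (A t - 2 * g t z)) / 2 ≤
      (2 * (Fintype.card κ : ℝ))⁻¹ * ∑ k,
        ((⨆ t, (A t + c * inner ℝ (θ t) (signedFeature φ (z, true, k)))) +
          ⨆ t, (A t + c * inner ℝ (θ t) (signedFeature φ (z, false, k)))) := by
    obtain ⟨t, ht⟩ := exists_eq_ciSup_of_finite (f := fun t => A t + 2 * g t z)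
    obtain ⟨s, hs⟩ := exists_eq_ciSup_of_finite (f := fun t => A t - 2 * g t z)
    rw [← ht, ← hs, le_inv_mul_iff₀ (by positivity)]
    have hk (k : κ) : A t + A s + c * |inner ℝ (θ t - θ s) (φ k z)| ≤
        (⨆ t, (A t + c * inner ℝ (θ t) (signedFeature φ (z, true, k)))) +
          ⨆ t, (A t + c * inner ℝ (θ t) (signedFeature φ (z, false, k))) := by
      have h1 := le_iSup_of_finite
        fun t => A t + c * inner ℝ (θ t) (signedFeature φ (z, true, k))
      have h2 := le_iSup_of_finite
        fun t => A t + c * inner ℝ (θ t) (signedFeature φ (z, false, k))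
      have h1t := h1 t; have h1s := h1 s; have h2t := h2 t; have h2s := h2 s
      simp only [signedFeature, cond_true, cond_false, inner_neg_right] at h1t h1s h2t h2s ⊢
      rw [inner_sub_left]
      -- The sign of the difference decides which of t and s is tested in the supremum with sign +;
      -- the other is tested in that with sign -.
      rcases abs_cases (inner ℝ (θ t) (φ k z) - inner ℝ (θ s) (φ k z)) with ⟨h, _⟩ | ⟨h, _⟩ <;>
        rw [h] <;> linarith
    refine le_trans ?_ (Finset.sum_le_sum fun k _ => hk k)
    rw [Finset.sum_add_distrib, ← Finset.mul_sum]
    simp only [Finset.sum_const, Finset.card_univ, nsmul_eq_mul]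
    have := mul_le_mul_of_nonneg_left (hL s t z)
      (by positivity : (0 : ℝ) ≤ 2 * Fintype.card κ)
    rw [hcdef]
    linarith
  calc _ ≤ ∫ z, (∫ z', ⨆ t, (A t + 2 * g t z') ∂μ + ⨆ t, (A t - 2 * g t z)) / 2 ∂μ :=
        integral_mono hI3 (((integrable_const _).add hI2).div_const _) hsym
    _ = ∫ z, ((⨆ t, (A t + 2 * g t z)) + ⨆ t, (A t - 2 * g t z)) / 2 ∂μ := by
        rw [integral_div, integral_div, integral_add (integrable_const _) hI2,
          integral_add hI1 hI2]
        simp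
    _ ≤ ∫ z, (2 * (Fintype.card κ : ℝ))⁻¹ * ∑ k,
        ((⨆ t, (A t + c * inner ℝ (θ t) (signedFeature φ (z, true, k)))) +
          ⨆ t, (A t + c * inner ℝ (θ t) (signedFeature φ (z, false, k)))) ∂μ := by
        refine integral_mono ((hI1.add hI2).div_const _)
          ((integrable_finsetSum _ fun k _ => ?_).const_mul _) hcontr
        have hmk (ε : Bool) : Measurable fun z : Z => (z, ε, k) := measurable_prodMk_right
        exact (integrable_of_measurable_of_abs_le (hwm.comp (hmk true)) fun z => hw _).add
          (integrable_of_measurable_of_abs_le (hwm.comp (hmk false)) fun z => hw _)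
    _ = _ := (integral_signIndexMeasure hwm hw).symm

/-- Uniform deviation bound over a finite subset of a ball. -/
theorem measureReal_exists_deviation_le_of_lipschitz {μ : Measure Z} [IsProbabilityMeasure μ]
    {T : Type*} [Finite T] [Nonempty T] {θ : T → F} {L B : ℝ} {g : F → Z → ℝ}
    (hg : ∀ θ, Measurable (g θ)) (hg01 : ∀ θ z, g θ z ∈ Set.Icc (0 : ℝ) 1)
    {φ : κ → Z → F} (hφ : ∀ k, Measurable (φ k)) (hφ1 : ∀ k z, ‖φ k z‖ ≤ 1) (hL0 : 0 ≤ L)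
    (hL : ∀ θ θ' z, g θ z - g θ' z ≤ L * ∑ k, |inner ℝ (θ - θ') (φ k z)|)
    (hθ : ∀ t, ‖θ t‖ ≤ B) {n : ℕ} (hn : 1 ≤ n) {s : ℝ} (hs : 0 ≤ s) :
    (Measure.pi fun _ => μ).real
      {S : Fin n → Z | ∃ t, 1 / (n : ℝ) * ∑ i, g (θ t) (S i) +
        2 * L * Fintype.card κ * B / √n + s < ∫ z, g (θ t) z ∂μ} ≤
      Real.exp (-(n * s ^ 2 / 2)) := by
  have hum := measurable_signedFeature hφ
  have hn0 : (0 : ℝ) < n := by exact_mod_cast hn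
  have habs (t : T) (z : Z) : |g (θ t) z| ≤ 1 :=
    abs_le.2 ⟨by linarith [(hg01 (θ t) z).1], (hg01 (θ t) z).2⟩
  have hc : 0 ≤ 2 * L * Fintype.card κ := by positivity
  have hB : 0 ≤ B := (norm_nonneg _).trans (hθ (Classical.arbitrary T))
  refine measureReal_exists_deviation_le (g := fun t => g (θ t)) (fun t => hg _)
    (fun t => hg01 _) hn hs ?_
  refine (integral_iSup_sum_le_integral_iSup_sum (ν := signIndexMeasure μ κ)
    (a := fun t z => ∫ z', g (θ t) z' ∂μ - g (θ t) z)
    (b := fun t w => 2 * L * Fintype.card κ * inner ℝ (θ t) (signedFeature φ w))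
    (α := 1 + 1) (β := 2 * L * Fintype.card κ * (B * 1)) (fun t => by fun_prop)
    (fun t => by fun_prop)
    (fun t z => (abs_sub _ _).trans (add_le_add (abs_integral_le_of_abs_le (habs t)) (habs t z)))
    (fun t w => ?_)
    (integral_iSup_integral_sub_le (fun t => hg (θ t)) (fun t => hg01 (θ t)) hφ hφ1 hL0
      fun s t => hL (θ t) (θ s)) n 0).trans ?_
  · rw [abs_mul, abs_of_nonneg hc]
    refine mul_le_mul_of_nonneg_left ((abs_real_inner_le_norm _ _).trans ?_) hc
    exact mul_le_mul (hθ t) (norm_signedFeature_le hφ1 w) (norm_nonneg _) hB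
  · refine (integral_iSup_inner_signedFeature_le hθ hc hφ hφ1 hn).trans (le_of_eq ?_)
    have h : (n : ℝ) / √n = √n := Real.div_sqrt
    rw [mul_div_assoc', mul_comm (n : ℝ), mul_div_assoc, h]

/-- Uniform deviation bound over a ball. -/
theorem exists_measurableSet_uniform_deviation {μ : Measure Z} [IsProbabilityMeasure μ]
    {L B : ℝ} {g : F → Z → ℝ}
    (hg : ∀ θ, Measurable (g θ)) (hg01 : ∀ θ z, g θ z ∈ Set.Icc (0 : ℝ) 1)
    {φ : κ → Z → F} (hφ : ∀ k, Measurable (φ k)) (hφ1 : ∀ k z, ‖φ k z‖ ≤ 1) (hL0 : 0 ≤ L)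
    (hL : ∀ θ θ' z, g θ z - g θ' z ≤ L * ∑ k, |inner ℝ (θ - θ') (φ k z)|)
    {n : ℕ} (hn : 1 ≤ n) {s : ℝ} (hs : 0 ≤ s) :
    ∃ E : Set (Fin n → Z), MeasurableSet E ∧
      (Measure.pi fun _ => μ).real Eᶜ ≤ Real.exp (-(n * s ^ 2 / 2)) ∧
      ∀ S ∈ E, ∀ θ : F, ‖θ‖ ≤ B → ∫ z, g θ z ∂μ ≤
        1 / (n : ℝ) * ∑ i, g θ (S i) + 2 * L * Fintype.card κ * B / √n + s := by
  rcases lt_or_ge B 0 with hB | hB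
  · refine ⟨Set.univ, .univ, by simpa using (Real.exp_pos _).le, fun S _ θ hθ => ?_⟩
    exact absurd ((norm_nonneg θ).trans hθ) (not_le.2 hB)
  have hne : Nonempty {θ : F // ‖θ‖ ≤ B} := ⟨⟨0, by simpa using hB⟩⟩
  set q : ℕ → {θ : F // ‖θ‖ ≤ B} := TopologicalSpace.denseSeq _ with hq
  set bad : F → Set (Fin n → Z) := fun θ => {S | 1 / (n : ℝ) * ∑ i, g θ (S i) +
        2 * L * Fintype.card κ * B / √n + s < ∫ z, g θ z ∂μ} with hbad
  have hbadm (θ : F) : MeasurableSet (bad θ) :=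
    measurableSet_lt (by fun_prop) measurable_const
  -- The finite-family bound does not depend on N, so continuity from below carries it to the whole
  -- sequence without a union bound.
  set U : ℕ → Set (Fin n → Z) := fun N => {S | ∃ j : Fin (N + 1), S ∈ bad (q j)} with hU
  have hUmono : Monotone U := by
    rintro N N' h S ⟨j, hj⟩
    exact ⟨⟨j, by omega⟩, hj⟩
  have hUiff : ⋃ N, U N = ⋃ N, bad (q N) := by
    ext S
    simp only [Set.mem_iUnion]
    constructor
    · rintro ⟨N, j, hj⟩; exact ⟨j, hj⟩
    · rintro ⟨N, hN⟩; exact ⟨N, Fin.last N, by simpa using hN⟩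
  have hlip (z : Z) : Continuous fun θ => g θ z := by
    have hK : 0 ≤ L * Fintype.card κ := by positivity
    refine (LipschitzWith.of_le_add_mul ⟨L * Fintype.card κ, hK⟩ fun θ θ' => ?_).continuous
    have h : L * ∑ k, |inner ℝ (θ - θ') (φ k z)| ≤ L * ∑ k : κ, dist θ θ' := by
      refine mul_le_mul_of_nonneg_left (Finset.sum_le_sum fun k _ => ?_) hL0
      rw [dist_eq_norm]
      exact (abs_real_inner_le_norm _ _).trans
        (mul_le_of_le_one_right (norm_nonneg _) (hφ1 k z))
    have h2 := hL θ θ' z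
    simp only [Finset.sum_const, Finset.card_univ, nsmul_eq_mul, ← mul_assoc] at h
    change g θ z ≤ g θ' z + L * Fintype.card κ * dist θ θ'
    linarith
  have hcont : Continuous fun θ => ∫ z, g θ z ∂μ :=
    continuous_of_dominated (bound := fun _ => 1) (fun θ => (hg θ).aestronglyMeasurable)
      (fun θ => .of_forall fun z => by
        rw [Real.norm_eq_abs]
        exact abs_le.2 ⟨by linarith [(hg01 θ z).1], (hg01 θ z).2⟩)
      (integrable_const _) (.of_forall hlip)
  refine ⟨(⋃ N, bad (q N))ᶜ, (MeasurableSet.iUnion fun N => hbadm _).compl, ?_, ?_⟩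
  · rw [compl_compl, ← hUiff, measureReal_def]
    refine ENNReal.toReal_le_of_le_ofReal (Real.exp_pos _).le ?_
    rw [hUmono.measure_iUnion]
    refine iSup_le fun N => ?_
    rw [← ofReal_measureReal]
    exact ENNReal.ofReal_le_ofReal (measureReal_exists_deviation_le_of_lipschitz
      (θ := fun j : Fin (N + 1) => (q j : F)) hg hg01 hφ hφ1 hL0 hL (fun j => (q j).2) hn hs)
  · intro S hS θ hθ
    -- Both sides are continuous in θ for a fixed sample, so the inequality is a closed condition
    -- and passes from the dense sequence to the ball.
    refine (TopologicalSpace.denseRange_denseSeq {θ : F // ‖θ‖ ≤ B}).induction_on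
      (p := fun θ => ∫ z, g θ z ∂μ ≤
        1 / (n : ℝ) * ∑ i, g θ (S i) + 2 * L * Fintype.card κ * B / √n + s) ⟨θ, hθ⟩
      (isClosed_le (hcont.comp continuous_subtype_val) ?_) fun N => ?_
    · have := fun i => (hlip (S i)).comp (continuous_subtype_val (p := fun θ : F => ‖θ‖ ≤ B))
      simp only [Function.comp_def] at this
      fun_prop
    · exact not_lt.1 fun h => hS (Set.mem_iUnion.2 ⟨N, h⟩)

end Rademacher

/-! ### The margin losses: range, domination, Lipschitz dependence on θ, measurability. -/

noncomputable section
namespace SPC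
variable {X : Type*} {ℓ d : ℕ} {K : Fin ℓ → ℕ}

/-- In the clamped form, range, Lipschitz constant and measurability can be read off. -/
theorem ramp_eq {γ : ℝ} (hγ : 0 < γ) (z : ℝ) : ramp γ z = max 0 (min 1 (1 - z / γ)) := by
  unfold ramp
  split_ifs with h1 h2
  · have : z / γ < 0 := div_neg_of_neg_of_pos h1 hγ
    rw [min_eq_left (by linarith), max_eq_right zero_le_one]
  · have h3 : 0 ≤ z / γ := div_nonneg (not_lt.1 h1) hγ.le
    have h4 : z / γ ≤ 1 := (div_le_one hγ).2 h2
    rw [min_eq_right (by linarith), max_eq_right (by linarith)]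
  · have h4 : 1 < z / γ := (one_lt_div hγ).2 (not_le.1 h2)
    rw [min_eq_right (by linarith), max_eq_left (by linarith)]

theorem ramp_mem_Icc {γ : ℝ} (hγ : 0 < γ) (z : ℝ) : ramp γ z ∈ Set.Icc (0 : ℝ) 1 := by
  rw [ramp_eq hγ]
  exact ⟨le_max_left _ _, max_le zero_le_one (min_le_left _ _)⟩

/-- The case z = 0 matters: the filtering loss counts a tie with the threshold as an error. -/
theorem ramp_of_nonpos {γ z : ℝ} (hγ : 0 < γ) (hz : z ≤ 0) : ramp γ z = 1 := by
  have : z / γ ≤ 0 := div_nonpos_of_nonpos_of_nonneg hz hγ.le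
  rw [ramp_eq hγ, min_eq_left (by linarith), max_eq_right zero_le_one]

theorem abs_ramp_sub_ramp_le {γ : ℝ} (hγ : 0 < γ) (a b : ℝ) :
    |ramp γ a - ramp γ b| ≤ |a - b| / γ := by
  rw [ramp_eq hγ, ramp_eq hγ]
  have h1 := abs_max_sub_max_le_max 0 (min 1 (1 - a / γ)) 0 (min 1 (1 - b / γ))
  have h2 := abs_min_sub_min_le_max 1 (1 - a / γ) 1 (1 - b / γ)
  have h3 : |1 - a / γ - (1 - b / γ)| = |a - b| / γ := by
    rw [show 1 - a / γ - (1 - b / γ) = -((a - b) / γ) by ring, abs_neg, abs_div, abs_of_pos hγ]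
  have h0 (r : ℝ) : |r - r| ≤ |a - b| / γ := by rw [sub_self, abs_zero]; positivity
  exact h1.trans (max_le (h0 _) (h2.trans (max_le (h0 _) h3.le)))

theorem measurable_ramp {γ : ℝ} (hγ : 0 < γ) : Measurable (ramp γ) := by
  have : ramp γ = fun z => max 0 (min 1 (1 - z / γ)) := funext (ramp_eq hγ)
  rw [this]
  fun_prop

/-- The sum over all clique assignments of the absolute clique scores. -/
def totalScore (C : Finset (Finset (Fin ℓ))) (f : CliqueFeatures X K d)
    (θ : EuclideanSpace ℝ (Fin d)) (x : X) : ℝ :=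
  ∑ c ∈ C, ∑ yc : CliqueAssignment K c, |inner ℝ θ (f c x yc)|

/-- The average of a function over all clique assignments. -/
def assignmentAverage (C : Finset (Finset (Fin ℓ)))
    (h : ∀ c : Finset (Fin ℓ), CliqueAssignment K c → ℝ) : ℝ :=
  1 / (numAssignments K C : ℝ) * ∑ c ∈ C, ∑ yc : CliqueAssignment K c, h c yc

theorem assignmentAverage_mono {C : Finset (Finset (Fin ℓ))}
    {h h' : ∀ c : Finset (Fin ℓ), CliqueAssignment K c → ℝ} (hh : ∀ c yc, h c yc ≤ h' c yc) :
    assignmentAverage C h ≤ assignmentAverage C h' :=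
  mul_le_mul_of_nonneg_left
    (Finset.sum_le_sum fun c _ => Finset.sum_le_sum fun yc _ => hh c yc) (by positivity)

/-- Only an inequality: with no assignments, 1 / 0 = 0 makes the average vanish. -/
theorem assignmentAverage_const_le (C : Finset (Finset (Fin ℓ))) {a : ℝ} (ha : 0 ≤ a) :
    assignmentAverage (K := K) C (fun _ _ => a) ≤ a := by
  have h : ∑ c ∈ C, ∑ _yc : CliqueAssignment K c, a = (numAssignments K C : ℝ) * a := by
    simp [numAssignments, Finset.sum_mul]
  rw [assignmentAverage, h, ← mul_assoc, one_div]
  exact mul_le_of_le_one_left ha (inv_mul_le_one)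

theorem assignmentAverage_nonneg {C : Finset (Finset (Fin ℓ))}
    {h : ∀ c : Finset (Fin ℓ), CliqueAssignment K c → ℝ} (hh : ∀ c yc, 0 ≤ h c yc) :
    0 ≤ assignmentAverage C h :=
  mul_nonneg (by positivity) (Finset.sum_nonneg fun c _ => Finset.sum_nonneg fun yc _ => hh c yc)

theorem abs_assignmentAverage_sub_le {C : Finset (Finset (Fin ℓ))}
    {h h' : ∀ c : Finset (Fin ℓ), CliqueAssignment K c → ℝ} {a : ℝ} (ha : 0 ≤ a)
    (hh : ∀ c yc, |h c yc - h' c yc| ≤ a) :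
    |assignmentAverage C h - assignmentAverage C h'| ≤ a := by
  have h1 : assignmentAverage C h - assignmentAverage C h' =
      assignmentAverage C fun c yc => h c yc - h' c yc := by
    simp only [assignmentAverage, Finset.sum_sub_distrib, mul_sub]
  have h2 : |assignmentAverage C fun c yc => h c yc - h' c yc| ≤
      assignmentAverage C fun c yc => |h c yc - h' c yc| := by
    simp only [assignmentAverage]
    rw [abs_mul, abs_of_nonneg (by positivity)]
    refine mul_le_mul_of_nonneg_left ?_ (by positivity)
    exact (Finset.abs_sum_le_sum_abs _ _).trans
      (Finset.sum_le_sum fun c _ => Finset.abs_sum_le_sum_abs _ _)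
  rw [h1]
  exact h2.trans ((assignmentAverage_mono hh).trans (assignmentAverage_const_le C ha))

theorem totalScore_nonneg (C : Finset (Finset (Fin ℓ))) (f : CliqueFeatures X K d)
    (θ : EuclideanSpace ℝ (Fin d)) (x : X) : 0 ≤ totalScore C f θ x :=
  Finset.sum_nonneg fun _ _ => Finset.sum_nonneg fun _ _ => abs_nonneg _

/-- An output uses one assignment per clique; adding the remaining ones makes the bound independent
of `y`, so it survives every maximum over outputs. -/
theorem abs_score_sub_le (C : Finset (Finset (Fin ℓ))) (f : CliqueFeatures X K d)
    (θ θ' : EuclideanSpace ℝ (Fin d)) (x : X) (y : Output K) :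
    |score C f θ x y - score C f θ' x y| ≤ totalScore C f (θ - θ') x := by
  rw [score, score, ← inner_sub_left, featureMap, inner_sum]
  exact (Finset.abs_sum_le_sum_abs _ _).trans (Finset.sum_le_sum fun c _ =>
    Finset.single_le_sum (f := fun yc : CliqueAssignment K c => |inner ℝ (θ - θ') (f c x yc)|)
      (fun _ _ => abs_nonneg _) (Finset.mem_univ (c.restrict y)))

/-- Any clique assignment extends to an output, so max-marginals are genuine maxima. -/
theorem nonempty_restrict_eq [Nonempty (Output K)] (c : Finset (Fin ℓ))
    (yc : CliqueAssignment K c) : Nonempty {y : Output K // c.restrict y = yc} := by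
  classical
  refine ⟨⟨fun i => if h : i ∈ c then yc ⟨i, h⟩ else Classical.arbitrary (Output K) i, ?_⟩⟩
  ext i
  simp [Finset.restrict]

theorem abs_maxScore_sub_le [Nonempty (Output K)] (C : Finset (Finset (Fin ℓ)))
    (f : CliqueFeatures X K d) (θ θ' : EuclideanSpace ℝ (Fin d)) (x : X) :
    |maxScore C f θ x - maxScore C f θ' x| ≤ totalScore C f (θ - θ') x :=
  abs_iSup_sub_iSup_le fun y => abs_score_sub_le C f θ θ' x y

theorem abs_maxMarginal_sub_le [Nonempty (Output K)] (C : Finset (Finset (Fin ℓ)))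
    (f : CliqueFeatures X K d) (θ θ' : EuclideanSpace ℝ (Fin d)) (x : X) (c : Finset (Fin ℓ))
    (yc : CliqueAssignment K c) :
    |maxMarginal C f θ x c yc - maxMarginal C f θ' x c yc| ≤ totalScore C f (θ - θ') x := by
  have := nonempty_restrict_eq c yc
  exact abs_iSup_sub_iSup_le fun y => abs_score_sub_le C f θ θ' x y.1

/-- The threshold is a convex combination of the maximum and a mean of max-marginals, which all obey
the same bound. -/
theorem abs_threshold_sub_le [Nonempty (Output K)] (C : Finset (Finset (Fin ℓ)))
    (f : CliqueFeatures X K d) {α : ℝ} (hα : α ∈ Set.Icc (0 : ℝ) 1)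
    (θ θ' : EuclideanSpace ℝ (Fin d)) (x : X) :
    |threshold C f α θ x - threshold C f α θ' x| ≤ totalScore C f (θ - θ') x := by
  have h1 := abs_maxScore_sub_le C f θ θ' x
  have h2 : |assignmentAverage C (maxMarginal C f θ x) -
      assignmentAverage C (maxMarginal C f θ' x)| ≤ totalScore C f (θ - θ') x :=
    abs_assignmentAverage_sub_le (totalScore_nonneg _ _ _ _)
      (abs_maxMarginal_sub_le C f θ θ' x)
  have h3 : threshold C f α θ x - threshold C f α θ' x =
      α * (maxScore C f θ x - maxScore C f θ' x) +
        (1 - α) * (assignmentAverage C (maxMarginal C f θ x) -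
          assignmentAverage C (maxMarginal C f θ' x)) := by
    simp only [threshold, assignmentAverage]; ring
  rw [h3]
  refine (abs_add_le _ _).trans ?_
  rw [abs_mul, abs_mul, abs_of_nonneg hα.1, abs_of_nonneg (sub_nonneg.2 hα.2)]
  nlinarith [mul_le_mul_of_nonneg_left h1 hα.1,
    mul_le_mul_of_nonneg_left h2 (sub_nonneg.2 hα.2)]

theorem abs_ramp_sub_sub_ramp_sub_le {γ a b a' b' Δ : ℝ} (hγ : 0 < γ) (ha : |a - a'| ≤ Δ)
    (hb : |b - b'| ≤ Δ) : |ramp γ (a - b) - ramp γ (a' - b')| ≤ 2 / γ * Δ := by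
  refine (abs_ramp_sub_ramp_le hγ _ _).trans ?_
  rw [div_mul_eq_mul_div, sub_sub_sub_comm]
  gcongr
  linarith [abs_sub (a - a') (b - b')]

theorem abs_marginFilteringLoss_sub_le [Nonempty (Output K)] (C : Finset (Finset (Fin ℓ)))
    (f : CliqueFeatures X K d) {α γ : ℝ} (hα : α ∈ Set.Icc (0 : ℝ) 1) (hγ : 0 < γ)
    (θ θ' : EuclideanSpace ℝ (Fin d)) (x : X) (y : Output K) :
    |marginFilteringLoss C f α γ θ x y - marginFilteringLoss C f α γ θ' x y| ≤
      2 / γ * totalScore C f (θ - θ') x :=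
  abs_ramp_sub_sub_ramp_sub_le hγ (abs_score_sub_le C f θ θ' x y)
    (abs_threshold_sub_le C f hα θ θ' x)

theorem abs_marginEfficiencyLoss_sub_le [Nonempty (Output K)] (C : Finset (Finset (Fin ℓ)))
    (f : CliqueFeatures X K d) {α γ : ℝ} (hα : α ∈ Set.Icc (0 : ℝ) 1) (hγ : 0 < γ)
    (θ θ' : EuclideanSpace ℝ (Fin d)) (x : X) (y : Output K) :
    |marginEfficiencyLoss C f α γ θ x y - marginEfficiencyLoss C f α γ θ' x y| ≤
      2 / γ * totalScore C f (θ - θ') x :=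
  abs_assignmentAverage_sub_le (mul_nonneg (by positivity) (totalScore_nonneg _ _ _ _))
    fun c yc => abs_ramp_sub_sub_ramp_sub_le hγ (abs_threshold_sub_le C f hα θ θ' x)
      (abs_maxMarginal_sub_le C f θ θ' x c yc)

theorem marginFilteringLoss_mem_Icc (C : Finset (Finset (Fin ℓ))) (f : CliqueFeatures X K d)
    (α : ℝ) {γ : ℝ} (hγ : 0 < γ) (θ : EuclideanSpace ℝ (Fin d)) (x : X) (y : Output K) :
    marginFilteringLoss C f α γ θ x y ∈ Set.Icc (0 : ℝ) 1 :=
  ramp_mem_Icc hγ _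

theorem marginEfficiencyLoss_mem_Icc (C : Finset (Finset (Fin ℓ))) (f : CliqueFeatures X K d)
    (α : ℝ) {γ : ℝ} (hγ : 0 < γ) (θ : EuclideanSpace ℝ (Fin d)) (x : X) (y : Output K) :
    marginEfficiencyLoss C f α γ θ x y ∈ Set.Icc (0 : ℝ) 1 :=
  ⟨assignmentAverage_nonneg fun _ _ => (ramp_mem_Icc hγ _).1,
    (assignmentAverage_mono fun _ _ => (ramp_mem_Icc hγ _).2).trans
      (assignmentAverage_const_le C zero_le_one)⟩

theorem filteringLoss_nonneg (C : Finset (Finset (Fin ℓ))) (f : CliqueFeatures X K d) (α : ℝ)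
    (θ : EuclideanSpace ℝ (Fin d)) (x : X) (y : Output K) : 0 ≤ filteringLoss C f α θ x y := by
  unfold filteringLoss; split_ifs <;> simp

theorem filteringLoss_le (C : Finset (Finset (Fin ℓ))) (f : CliqueFeatures X K d) (α : ℝ)
    {γ : ℝ} (hγ : 0 < γ) (θ : EuclideanSpace ℝ (Fin d)) (x : X) (y : Output K) :
    filteringLoss C f α θ x y ≤ marginFilteringLoss C f α γ θ x y := by
  unfold filteringLoss marginFilteringLoss
  split_ifs with h
  · rw [ramp_of_nonpos hγ (sub_nonpos.2 h)]
  · exact (ramp_mem_Icc hγ _).1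

theorem efficiencyLoss_nonneg (C : Finset (Finset (Fin ℓ))) (f : CliqueFeatures X K d) (α : ℝ)
    (θ : EuclideanSpace ℝ (Fin d)) (x : X) (y : Output K) : 0 ≤ efficiencyLoss C f α θ x y :=
  assignmentAverage_nonneg fun _ _ => by split_ifs <;> simp

theorem efficiencyLoss_le (C : Finset (Finset (Fin ℓ))) (f : CliqueFeatures X K d) (α : ℝ)
    {γ : ℝ} (hγ : 0 < γ) (θ : EuclideanSpace ℝ (Fin d)) (x : X) (y : Output K) :
    efficiencyLoss C f α θ x y ≤ marginEfficiencyLoss C f α γ θ x y :=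
  assignmentAverage_mono fun _ _ => by
    split_ifs with h
    · rw [ramp_of_nonpos hγ (sub_nonpos.2 h.le)]
    · exact (ramp_mem_Icc hγ _).1

section Measurability

variable [MeasurableSpace X] {C : Finset (Finset (Fin ℓ))} {f : CliqueFeatures X K d}

theorem measurable_score
    (hf : ∀ a ∈ C, ∀ ya : CliqueAssignment K a, Measurable fun x => f a x ya)
    (θ : EuclideanSpace ℝ (Fin d)) (y : Output K) : Measurable fun x => score C f θ x y :=
  Measurable.const_inner (Finset.measurable_fun_sum C fun c hc => hf c hc _)

theorem measurable_maxMarginal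
    (hf : ∀ a ∈ C, ∀ ya : CliqueAssignment K a, Measurable fun x => f a x ya)
    (θ : EuclideanSpace ℝ (Fin d)) (c : Finset (Fin ℓ)) (yc : CliqueAssignment K c) :
    Measurable fun x => maxMarginal C f θ x c yc :=
  Measurable.iSup fun y => measurable_score hf θ y.1

theorem measurable_threshold
    (hf : ∀ a ∈ C, ∀ ya : CliqueAssignment K a, Measurable fun x => f a x ya)
    (α : ℝ) (θ : EuclideanSpace ℝ (Fin d)) : Measurable fun x => threshold C f α θ x := by
  have h1 : Measurable fun x => maxScore C f θ x := Measurable.iSup fun y => measurable_score hf θ y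
  have h2 := fun c yc => measurable_maxMarginal hf θ c yc
  unfold threshold
  fun_prop

theorem measurable_marginFilteringLoss
    (hf : ∀ a ∈ C, ∀ ya : CliqueAssignment K a, Measurable fun x => f a x ya)
    (α : ℝ) {γ : ℝ} (hγ : 0 < γ) (θ : EuclideanSpace ℝ (Fin d)) :
    Measurable fun z : X × Output K => marginFilteringLoss C f α γ θ z.1 z.2 :=
  measurable_from_prod_countable_left fun y =>
    (measurable_ramp hγ).comp ((measurable_score hf θ y).sub (measurable_threshold hf α θ))

theorem measurable_marginEfficiencyLoss
    (hf : ∀ a ∈ C, ∀ ya : CliqueAssignment K a, Measurable fun x => f a x ya)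
    (α : ℝ) {γ : ℝ} (hγ : 0 < γ) (θ : EuclideanSpace ℝ (Fin d)) :
    Measurable fun z : X × Output K => marginEfficiencyLoss C f α γ θ z.1 z.2 :=
  measurable_from_prod_countable_left fun _ => Measurable.const_mul
    (Finset.measurable_fun_sum _ fun c _ => Finset.measurable_fun_sum _ fun yc _ =>
      (measurable_ramp hγ).comp
        ((measurable_threshold hf α θ).sub (measurable_maxMarginal hf θ c yc))) _

end Measurability

/-! ### The generalization bound for one loss, and the two losses together. -/

theorem empiricalLoss_eq_expectedLoss_of_const [MeasurableSpace X] {D : Measure (X × Output K)}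
    [IsProbabilityMeasure D] {n : ℕ} (hn : 1 ≤ n) (S : Fin n → X × Output K) (a : ℝ) :
    empiricalLoss S (fun _ _ => a) = expectedLoss D (fun _ _ => a) := by
  have hn0 : (n : ℝ) ≠ 0 := by positivity
  simp [empiricalLoss, expectedLoss, hn0]

/-- Margin-based generalization bound for a loss dominated by a margin loss that is Lipschitz in
the clique scores. -/
theorem exists_measurableSet_expectedLoss_le [MeasurableSpace X] {D : Measure (X × Output K)}
    [IsProbabilityMeasure D] {C : Finset (Finset (Fin ℓ))} (hC : C.Nonempty)
    {f : CliqueFeatures X K d}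
    (hf : ∀ a ∈ C, ∀ ya : CliqueAssignment K a, Measurable fun x => f a x ya)
    (hf1 : ∀ a ∈ C, ∀ (x : X) (ya : CliqueAssignment K a), ‖f a x ya‖ ≤ 1) {γ : ℝ} (hγ : 0 < γ)
    (B : ℝ) {loss marginLoss : EuclideanSpace ℝ (Fin d) → X → Output K → ℝ}
    (hloss0 : ∀ θ x y, 0 ≤ loss θ x y) (hloss : ∀ θ x y, loss θ x y ≤ marginLoss θ x y)
    (hm : ∀ θ, Measurable fun z : X × Output K => marginLoss θ z.1 z.2)
    (h01 : ∀ θ x y, marginLoss θ x y ∈ Set.Icc (0 : ℝ) 1)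
    (hlip : ∀ θ θ' x y, |marginLoss θ x y - marginLoss θ' x y| ≤
      2 / γ * totalScore C f (θ - θ') x)
    {n : ℕ} (hn : 1 ≤ n) {δ : ℝ} (hδ0 : 0 < δ) (hδ1 : δ < 1) :
    ∃ E : Set (Fin n → X × Output K), MeasurableSet E ∧
      (Measure.pi fun _ : Fin n => D).real Eᶜ ≤ δ / 2 ∧
      ∀ S ∈ E, ∀ θ : EuclideanSpace ℝ (Fin d), ‖θ‖ ≤ B →
        expectedLoss D (loss θ) ≤ empiricalLoss S (marginLoss θ) +
          4 * (numAssignments K C : ℝ) * B * √(C.card : ℝ) / (γ * √(n : ℝ)) +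
          √(8 * Real.log (2 / δ) / (n : ℝ)) := by
  have hn0 : (0 : ℝ) < n := by exact_mod_cast hn
  obtain ⟨z₀⟩ := nonempty_of_isProbabilityMeasure D
  let κ := Σ c : C, CliqueAssignment K c.1
  have hcard : Fintype.card κ = numAssignments K C := by
    simp only [κ, Fintype.card_sigma, numAssignments]
    exact Finset.sum_coe_sort C fun c => Fintype.card (CliqueAssignment K c)
  obtain ⟨c₀, hc₀⟩ := hC
  have : Nonempty κ := ⟨⟨⟨c₀, hc₀⟩, c₀.restrict z₀.2⟩⟩
  let _ : MeasurableSpace κ := ⊤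
  have : DiscreteMeasurableSpace κ := ⟨fun _ => trivial⟩
  let φ : κ → X × Output K → EuclideanSpace ℝ (Fin d) := fun k z => f k.1 z.1 k.2
  have htotal (θ : EuclideanSpace ℝ (Fin d)) (z : X × Output K) :
      totalScore C f θ z.1 = ∑ k : κ, |inner ℝ θ (φ k z)| := by
    rw [Fintype.sum_sigma]
    exact (Finset.sum_coe_sort C
      fun c => ∑ yc : CliqueAssignment K c, |inner ℝ θ (f c z.1 yc)|).symm
  have hlog : 0 < Real.log (2 / δ) := Real.log_pos (by rw [lt_div_iff₀ hδ0]; linarith)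
  obtain ⟨E, hE, hEp, hES⟩ := exists_measurableSet_uniform_deviation (μ := D) (B := B)
    (g := fun θ z => marginLoss θ z.1 z.2) (φ := φ) (L := 2 / γ) hm (fun θ z => h01 θ z.1 z.2)
    (fun k => (hf k.1 k.1.2 k.2).comp measurable_fst) (fun k z => hf1 k.1 k.1.2 z.1 k.2)
    (by positivity) (fun θ θ' z => by
      rw [← htotal]; exact (le_abs_self _).trans (hlip θ θ' z.1 z.2)) hn
    (Real.sqrt_nonneg (8 * Real.log (2 / δ) / (n : ℝ)))
  refine ⟨E, hE, hEp.trans ?_, fun S hS θ hθ => ?_⟩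
  -- The deviation term gives failure probability (δ/2)⁴, more than is needed.
  · rw [Real.sq_sqrt (by positivity)]
    have h1 : (n : ℝ) * (8 * Real.log (2 / δ) / n) / 2 = 4 * Real.log (2 / δ) := by
      field_simp; ring
    rw [h1]
    calc Real.exp (-(4 * Real.log (2 / δ))) ≤ Real.exp (-Real.log (2 / δ)) :=
          Real.exp_le_exp.2 (by linarith)
      _ = δ / 2 := by rw [Real.exp_neg, Real.exp_log (by positivity), inv_div]
  · have hB : 0 ≤ B := (norm_nonneg θ).trans hθ
    have h1 : expectedLoss D (loss θ) ≤ ∫ z, marginLoss θ z.1 z.2 ∂D :=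
      integral_mono_of_nonneg (.of_forall fun z => hloss0 θ z.1 z.2)
        (integrable_of_measurable_of_abs_le (M := 1) (hm θ) fun z =>
          abs_le.2 ⟨by linarith [(h01 θ z.1 z.2).1], (h01 θ z.1 z.2).2⟩)
        (.of_forall fun z => hloss θ z.1 z.2)
    have h2 := hES S hS θ hθ
    -- The constant 4 is 2L with L = 2/γ; the factor √|𝒞| ≥ 1 is inserted for free.
    have h3 : 2 * (2 / γ) * (Fintype.card κ : ℝ) * B / √n ≤
        4 * (numAssignments K C : ℝ) * B * √(C.card : ℝ) / (γ * √(n : ℝ)) := by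
      have h4 : 1 ≤ √(C.card : ℝ) := by
        rw [Real.one_le_sqrt]
        exact_mod_cast Finset.card_pos.2 ⟨c₀, hc₀⟩
      rw [hcard, show 2 * (2 / γ) * (numAssignments K C : ℝ) * B / √n =
        4 * (numAssignments K C : ℝ) * B / (γ * √(n : ℝ)) by field_simp; ring]
      exact div_le_div_of_nonneg_right (le_mul_of_one_le_right (by positivity) h4) (by positivity)
    simp only [empiricalLoss]
    linarith

end SPC

end

theorem theorem1 :
    ∃ c : ℝ, ∀ (X : Type*) [MeasurableSpace X] (ℓ d : ℕ) (K : Fin ℓ → ℕ)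
      (C : Finset (Finset (Fin ℓ))) (f : SPC.CliqueFeatures X K d)
      (D : Measure (X × SPC.Output K)) [IsProbabilityMeasure D] (α γ B : ℝ),
      α ∈ Set.Icc (0 : ℝ) 1 → 0 < γ →
      (∀ a ∈ C, ∀ ya : SPC.CliqueAssignment K a, Measurable fun x => f a x ya) →
      (∀ a ∈ C, ∀ (x : X) (ya : SPC.CliqueAssignment K a), ‖f a x ya‖ ≤ 1) →
      ∀ (n : ℕ) (δ : ℝ), 1 ≤ n → 0 < δ → δ < 1 →
        ∃ E : Set (Fin n → X × SPC.Output K), MeasurableSet E ∧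
          1 - δ ≤ (Measure.pi fun _ : Fin n => D).real E ∧
          ∀ S ∈ E, ∀ θ : EuclideanSpace ℝ (Fin d), ‖θ‖ ≤ B →
            SPC.expectedLoss D (SPC.filteringLoss C f α θ) ≤
                SPC.empiricalLoss S (SPC.marginFilteringLoss C f α γ θ) +
                  c * (SPC.numAssignments K C : ℝ) * B * √(C.card : ℝ) / (γ * √(n : ℝ)) +
                  √(8 * Real.log (2 / δ) / (n : ℝ)) ∧
            SPC.expectedLoss D (SPC.efficiencyLoss C f α θ) ≤
                SPC.empiricalLoss S (SPC.marginEfficiencyLoss C f α γ θ) +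
                  c * (SPC.numAssignments K C : ℝ) * B * √(C.card : ℝ) / (γ * √(n : ℝ)) +
                  √(8 * Real.log (2 / δ) / (n : ℝ)) := by
  refine ⟨4, ?_⟩
  intro X _ ℓ d K C f D _ α γ B hα hγ hf hf1 n δ hn hδ0 hδ1
  obtain ⟨z₀⟩ := nonempty_of_isProbabilityMeasure D
  have : Nonempty (SPC.Output K) := ⟨z₀.2⟩
  -- Without cliques there is no assignment to draw at random. Scores and threshold vanish, and each
  -- loss and its margin version equal the same constant: 1 for filtering, 0 for efficiency.
  rcases C.eq_empty_or_nonempty with rfl | hC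
  · have hscore (θ : EuclideanSpace ℝ (Fin d)) (x : X) (y : SPC.Output K) :
        SPC.score ∅ f θ x y = 0 := by simp [SPC.score, SPC.featureMap]
    have hthr (θ : EuclideanSpace ℝ (Fin d)) (x : X) : SPC.threshold ∅ f α θ x = 0 := by
      simp [SPC.threshold, SPC.maxScore, hscore]
    refine ⟨Set.univ, .univ, by simpa using hδ0.le, fun S _ θ _ => ⟨?_, ?_⟩⟩
    · have h1 : SPC.filteringLoss ∅ f α θ = fun _ _ => 1 := by
        funext x y; simp [SPC.filteringLoss, hscore, hthr]
      have h2 : SPC.marginFilteringLoss ∅ f α γ θ = fun _ _ => 1 := by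
        funext x y; simp [SPC.marginFilteringLoss, hscore, hthr, SPC.ramp_of_nonpos hγ le_rfl]
      rw [h1, h2, SPC.empiricalLoss_eq_expectedLoss_of_const (D := D) hn]
      simpa using by positivity
    · have h1 : SPC.efficiencyLoss ∅ f α θ = fun _ _ => 0 := by
        funext x y; simp [SPC.efficiencyLoss]
      have h2 : SPC.marginEfficiencyLoss ∅ f α γ θ = fun _ _ => 0 := by
        funext x y; simp [SPC.marginEfficiencyLoss]
      rw [h1, h2, SPC.empiricalLoss_eq_expectedLoss_of_const (D := D) hn]
      simpa using by positivity
  · obtain ⟨E₁, hE₁, hp₁, h₁⟩ := SPC.exists_measurableSet_expectedLoss_le (D := D) hC hf hf1 hγ B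
      (SPC.filteringLoss_nonneg C f α) (SPC.filteringLoss_le C f α hγ)
      (SPC.measurable_marginFilteringLoss hf α hγ) (SPC.marginFilteringLoss_mem_Icc C f α hγ)
      (SPC.abs_marginFilteringLoss_sub_le C f hα hγ) hn hδ0 hδ1
    obtain ⟨E₂, hE₂, hp₂, h₂⟩ := SPC.exists_measurableSet_expectedLoss_le (D := D) hC hf hf1 hγ B
      (SPC.efficiencyLoss_nonneg C f α) (SPC.efficiencyLoss_le C f α hγ)
      (SPC.measurable_marginEfficiencyLoss hf α hγ) (SPC.marginEfficiencyLoss_mem_Icc C f α hγ)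
      (SPC.abs_marginEfficiencyLoss_sub_le C f hα hγ) hn hδ0 hδ1
    -- Each event fails with probability at most δ/2, hence the 2/δ in the logarithm.
    refine ⟨E₁ ∩ E₂, hE₁.inter hE₂, ?_, fun S hS θ hθ => ⟨h₁ S hS.1 θ hθ, h₂ S hS.2 θ hθ⟩⟩
    have hcompl := probReal_compl_eq_one_sub (μ := Measure.pi fun _ : Fin n => D)
      (hE₁.inter hE₂)
    have hunion := measureReal_union_le (μ := Measure.pi fun _ : Fin n => D) E₁ᶜ E₂ᶜ
    rw [Set.compl_inter] at hcompl
    linarith
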